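/- **Hub model with a null component.** There are $n$ nodes $\{1,\dots,n\}$, of which $1,\dots,n_L$ ($n_L\le n$) are the possible hubs. The parameters are a probability vector $\rho=(\rho_0,\dots,\rho_{n_L})$ and a matrix $A=(A_{ij})_{0\le i\le n_L,\,1\le j\le n}$ with entries in $[0,1]$ and $A_{ii}=1$ for $1\le i\le n_L$. Independently for $t=1,\dots,T$, a true label $z_*^{(t)}\in\{0,\dots,n_L\}$ is drawn with $\mathbb P(z_*^{(t)}=i)=\rho_i$ (the label $0$ means a hubless group), and, given $z_*^{(t)}=i$, each node $j$ belongs to group $t$ ($G^{(t)}_j=1$, otherwise $G_j^{(t)}=0$) independently with probability $A_{ij}$. For $z\in\{0,\dots,n_L\}^T$ let $$L_G(z)=\max_{B}\sum_{t=1}^T\sum_{j=1}^n\Big[G_j^{(t)}\log B_{z^{(t)}j}+(1-G_j^{(t)})\log(1-B_{z^{(t)}j})\Big]$$ be the profile log-likelihood, where $B$ runs over all $(n_L+1)\times n$ matrices with entries in $[0,1]$ and $B_{ii}=1$ for $1\le i\le n_L$ (with $\log 0=-\infty$ and $0\cdot\log 0=0$), and let $\hat z$ be a maximizer of $L_G$.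 Let $t_{i*}$ be the number of $t$ with $z_*^{(t)}=i$, and $t_{i0}$ the number of $t$ with $z_*^{(t)}=i$ and $\hat z^{(t)}=0$. **Theorem.** Let $n_L,n,T\to\infty$; all of $\rho,A,d,v$ may vary with $(n_L,n,T)$, with $d,v>0$. Assume that there are positive constants $c_{\min},c_{\max},c_0$ with $c_{\min}/n_L\le\rho_i\le c_{\max}/n_L$ for $i=0,\dots,n_L$, and that (i) for each $i=1,\dots,n_L$ there is a set $V_i\subset\{1,\dots,n\}$ with $|V_i|\ge vn/n_L$ and $A_{ij}-A_{i'j}\ge d$ for all $j\in V_i$ and all $i'\in\{0,\dots,n_L\}$, $i'\ne i$; (ii) $A_{ii'}\le c_0/n_L$ for all $i\in\{0,\dots,n_L\}$, $i'\in\{1,\dots,n_L\}$, $i\ne i'$. If $$\frac{n_L^2\log n_L}{T}=o(1),\qquad \frac{n_L^5\log T}{d^2vT}=o(1),\qquad \frac{n_L^8\log n_L}{d^4v^2n}=o(1),$$ then for every $\eta>0$, with probability tending to $1$, simultaneously for all $i=1,\dots,n_L$, $t_{i*}>0$ and $$\frac{t_{i0}}{t_{i*}}\le\eta .$$ -/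

import Mathlib

namespace HubModel

/-! Hub labels are elements of `Fin (nL + 1)`: the label `0` is the null component (hubless
groups), and the label `i.succ` is the leader `i : Fin nL`. Nodes are elements of `Fin n`; the
leaders are the first `nL` nodes, the leader `i` being the node `Fin.castLE h i`, `h : nL ≤ n`.
A data set of `T` groups is `g : Fin T → Fin n → Bool`, with `g t j = true` iff node `j` appears
in group `t`. -/

/-- The probability that a Bernoulli variable of parameter `p` takes the value `b`. -/
def bern (p : ℝ) (b : Bool) : ℝ := if b then p else 1 - p

/-- The parameter space for the matrix `A` (row `0` is the null component): all entries are
probabilities, and a hub always belongs to its own groups. -/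
def paramSpace {nL n : ℕ} (h : nL ≤ n) : Set (Matrix (Fin (nL + 1)) (Fin n) ℝ) :=
  {A | (∀ i j, A i j ∈ Set.Icc (0 : ℝ) 1) ∧ ∀ i : Fin nL, A i.succ (Fin.castLE h i) = 1}

/-- The hub model with a null component: `zs` (true hub labels) and `G` (groups) are random
variables such that the pairs `(zs t, G t)`, `t : Fin T`, are independent, `zs t` has law `ρ`, and
given `zs t = i` the nodes `j` appear independently with probabilities `A i j`. -/
structure IsHubNullModel {Ω : Type*} [MeasurableSpace Ω] (μ : MeasureTheory.Measure Ω)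
    {nL n T : ℕ} (ρ : Fin (nL + 1) → ℝ) (A : Matrix (Fin (nL + 1)) (Fin n) ℝ)
    (zs : Ω → Fin T → Fin (nL + 1)) (G : Ω → Fin T → Fin n → Bool) : Prop where
  measurable_zs : Measurable zs
  measurable_G : Measurable G
  law : ∀ (z : Fin T → Fin (nL + 1)) (g : Fin T → Fin n → Bool),
    μ.real {ω | zs ω = z ∧ G ω = g} = ∏ t, (ρ (z t) * ∏ j, bern (A (z t) j) (g t j))

/-- The log-likelihood `L_G(A | z)` of the data `g` given the labels `z`, with values in
`[-∞, 0]` for `A` in the parameter space (`log 0 = -∞`). -/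
noncomputable def logLik {nL n T : ℕ} (g : Fin T → Fin n → Bool)
    (A : Matrix (Fin (nL + 1)) (Fin n) ℝ) (z : Fin T → Fin (nL + 1)) : EReal :=
  ∑ t, ∑ j, ENNReal.log (ENNReal.ofReal (bern (A (z t) j) (g t j)))

/-- The profile log-likelihood `L_G(z)`, the maximum of `L_G(A | z)` over the parameter space. -/
noncomputable def profileLogLik {nL n T : ℕ} (h : nL ≤ n) (g : Fin T → Fin n → Bool)
    (z : Fin T → Fin (nL + 1)) : EReal :=
  ⨆ A ∈ paramSpace h, logLik g A z

/-- `z` is a maximum profile likelihood estimate of the hub labels from the data `g`. -/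
def IsProfileMLE {nL n T : ℕ} (h : nL ≤ n) (g : Fin T → Fin n → Bool)
    (z : Fin T → Fin (nL + 1)) : Prop :=
  ∀ z' : Fin T → Fin (nL + 1), profileLogLik h g z' ≤ profileLogLik h g z

/-- The number `t_{i*}` of groups whose true label is `i`. -/
def trueCount {nL T : ℕ} (zs : Fin T → Fin (nL + 1)) (i : Fin (nL + 1)) : ℕ :=
  (Finset.univ.filter fun t => zs t = i).card

/-- The number `t_{ik}` of groups with true label `i` and estimated label `k`. -/
def crossCount {nL T : ℕ} (zs zhat : Fin T → Fin (nL + 1)) (i k : Fin (nL + 1)) : ℕ :=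
  (Finset.univ.filter fun t => zs t = i ∧ zhat t = k).card

end HubModel

namespace HubModel

open MeasureTheory

/-! For fixed labels the best matrix, with the hub constraint dropped, consists of empirical
frequencies, so an estimate `zhat` comes with a frequency matrix whose likelihood is at least that
of the truth (`IsProfileMLE.lik_le`). Labels and frequency matrices form a finite set. For each of
its members, the probability of beating the truth is at most a Hellinger affinity, exponentially
small in the squared distance `sqDist` of the mean matrices. A union bound (`measure_lik_le`) leaves
only pairs with `sqDist` at most `R`.

Closeness makes the estimated classes nearly pure: two true classes sharing an estimated class share
one fitted row, which by condition (i) cannot approximate both true rows, so one of the two cells is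
small (`min_crossCount_mul_le`). As every true class is large, each has a dominant estimated class,
and these are distinct: up to small cells, `zhat` permutes the labels.

The hub constraint identifies the permutation. A group is assigned to a hub only if it contains that
node (`hub_mem`), which by condition (ii) is rare for groups of another label. Hence label `i` goes
to `i` or `0`; then `0` goes to `0`, and injectivity forbids `0` to any hub
(`cross_zero_le_of_separated`). Chernoff bounds control the class sizes and the rare events. -/

/-! ### Likelihoods as real products -/

lemma bern_nonneg {p : ℝ} (hp : p ∈ Set.Icc (0 : ℝ) 1) (b : Bool) : 0 ≤ bern p b := by
  cases b
  · simpa [bern] using hp.2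
  · simpa [bern] using hp.1

lemma sum_bern (p : ℝ) : ∑ b, bern p b = 1 := by
  simp [bern]

lemma log_ofReal_prod {ι : Type*} (s : Finset ι) (f : ι → ℝ) (hf : ∀ i ∈ s, 0 ≤ f i) :
    ENNReal.log (ENNReal.ofReal (∏ i ∈ s, f i)) =
      ∑ i ∈ s, ENNReal.log (ENNReal.ofReal (f i)) := by
  classical
  induction s using Finset.induction_on with
  | empty => simp
  | insert a s ha ih =>
    rw [Finset.prod_insert ha, Finset.sum_insert ha,
      ENNReal.ofReal_mul (hf a (Finset.mem_insert_self a s)), ENNReal.log_mul_add,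
      ih fun i hi => hf i (Finset.mem_insert_of_mem hi)]

/-- The likelihood of the data `g` given the labels `z`. -/
noncomputable def lik {nL n T : ℕ} (A : Matrix (Fin (nL + 1)) (Fin n) ℝ)
    (z : Fin T → Fin (nL + 1)) (g : Fin T → Fin n → Bool) : ℝ :=
  ∏ t, ∏ j, bern (A (z t) j) (g t j)

lemma lik_nonneg {nL n T : ℕ} {A : Matrix (Fin (nL + 1)) (Fin n) ℝ}
    (hA : ∀ i j, A i j ∈ Set.Icc (0 : ℝ) 1) (z : Fin T → Fin (nL + 1))
    (g : Fin T → Fin n → Bool) : 0 ≤ lik A z g :=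
  Finset.prod_nonneg fun _ _ => Finset.prod_nonneg fun _ _ => bern_nonneg (hA _ _) _

lemma logLik_eq_log_lik {nL n T : ℕ} {A : Matrix (Fin (nL + 1)) (Fin n) ℝ}
    (hA : ∀ i j, A i j ∈ Set.Icc (0 : ℝ) 1) (z : Fin T → Fin (nL + 1))
    (g : Fin T → Fin n → Bool) :
    logLik g A z = ENNReal.log (ENNReal.ofReal (lik A z g)) := by
  unfold lik logLik
  rw [log_ofReal_prod _ _ fun t _ => Finset.prod_nonneg fun j _ => bern_nonneg (hA _ _) _]
  refine Finset.sum_congr rfl fun t _ => ?_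
  rw [log_ofReal_prod _ _ fun j _ => bern_nonneg (hA _ _) _]

/-! ### Empirical frequencies and the profile maximizer -/

lemma freq_mem_Icc (a b : ℕ) : (a : ℝ) / (a + b) ∈ Set.Icc (0 : ℝ) 1 :=
  ⟨by positivity, div_le_one_of_le₀ (by simp) (by positivity)⟩

/-- The empirical frequency maximizes the Bernoulli likelihood. -/
lemma pow_mul_pow_le_freq {b : ℝ} (hb : b ∈ Set.Icc (0 : ℝ) 1) (m l : ℕ) :
    b ^ m * (1 - b) ^ l ≤
      ((m : ℝ) / (m + l)) ^ m * (1 - (m : ℝ) / (m + l)) ^ l := by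
  -- This is `1 + u ≤ exp u` at `u = x * s / k - 1`, raised to the power `k`. With `s = m + l`, the
  -- exponential corrections for `b` and `1 - b` cancel.
  have key : ∀ (x s : ℝ) (k : ℕ), 0 ≤ x → 0 < s →
      x ^ k ≤ ((k : ℝ) / s) ^ k * Real.exp (x * s - k) := by
    intro x s k hx hs
    rcases Nat.eq_zero_or_pos k with rfl | hk
    · simpa using mul_nonneg hx hs.le
    · have hk' : (0 : ℝ) < k := by exact_mod_cast hk
      have h1 : x ≤ (k / s) * Real.exp (x * s / k - 1) := by
        have := Real.add_one_le_exp (x * s / k - 1)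
        calc x = (k / s) * (x * s / k - 1 + 1) := by field_simp; ring
          _ ≤ _ := by gcongr
      calc x ^ k ≤ ((k / s) * Real.exp (x * s / k - 1)) ^ k := pow_le_pow_left₀ hx h1 k
        _ = _ := by
          rw [mul_pow, ← Real.exp_nat_mul]
          congr 2
          field_simp
  -- For an empty class the frequency is `0 / 0 = 0`, harmless because both exponents vanish.
  by_cases h0 : m + l = 0
  · obtain ⟨rfl, rfl⟩ : m = 0 ∧ l = 0 := by omega
    simp
  have hs : (0 : ℝ) < m + l := by exact_mod_cast Nat.pos_of_ne_zero h0
  have h1 := key b (m + l) m hb.1 hs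
  have h2 := key (1 - b) (m + l) l (by linarith [hb.2]) hs
  have h3 : 1 - (m : ℝ) / (m + l) = l / (m + l) := by field_simp; ring
  rw [h3]
  calc b ^ m * (1 - b) ^ l
      ≤ (((m : ℝ) / (m + l)) ^ m * Real.exp (b * (m + l) - m)) *
        (((l : ℝ) / (m + l)) ^ l * Real.exp ((1 - b) * (m + l) - l)) :=
        mul_le_mul h1 h2 (pow_nonneg (by linarith [hb.2]) _) (by positivity)
    _ = ((m : ℝ) / (m + l)) ^ m * (l / (m + l)) ^ l *
        (Real.exp (b * (m + l) - m) * Real.exp ((1 - b) * (m + l) - l)) := by ring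
    _ = _ := by
      rw [← Real.exp_add]
      have : b * ((m : ℝ) + l) - m + ((1 - b) * (m + l) - l) = 0 := by ring
      rw [this]; simp

lemma prod_bern_eq {ι : Type*} (s : Finset ι) (x : ι → Bool) (b : ℝ) :
    ∏ t ∈ s, bern b (x t) =
      b ^ (s.filter fun t => x t = true).card * (1 - b) ^ (s.filter fun t => ¬ x t = true).card := by
  unfold bern
  rw [Finset.prod_ite, Finset.prod_const, Finset.prod_const]

/-- Matrices of frequencies `a / (a + b)` with `a, b ≤ T`. -/
noncomputable def freqMatrix {nL n T : ℕ}
    (c : Fin (nL + 1) → Fin n → Fin (T + 1) × Fin (T + 1)) : Matrix (Fin (nL + 1)) (Fin n) ℝ :=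
  fun k j => ((c k j).1 : ℕ) / (((c k j).1 : ℕ) + ((c k j).2 : ℕ))

lemma freqMatrix_mem_Icc {nL n T : ℕ} (c : Fin (nL + 1) → Fin n → Fin (T + 1) × Fin (T + 1))
    (k : Fin (nL + 1)) (j : Fin n) : freqMatrix c k j ∈ Set.Icc (0 : ℝ) 1 :=
  freq_mem_Icc _ _

/-- Counting presences and absences in each class of `z` maximizes every entry separately. Counts
are at most `T`, so the candidates form a finite set, as the union bound needs. -/
lemma exists_freqMatrix_lik_ge {nL n T : ℕ} (z : Fin T → Fin (nL + 1))
    (g : Fin T → Fin n → Bool) :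
    ∃ c : Fin (nL + 1) → Fin n → Fin (T + 1) × Fin (T + 1),
      ∀ B : Matrix (Fin (nL + 1)) (Fin n) ℝ, (∀ i j, B i j ∈ Set.Icc (0 : ℝ) 1) →
        lik B z g ≤ lik (freqMatrix c) z g := by
  have hlt : ∀ s : Finset (Fin T), s.card < T + 1 := fun s =>
    Nat.lt_succ_of_le ((Finset.card_le_univ s).trans (by simp))
  refine ⟨fun k j => (⟨_, hlt ((Finset.univ.filter fun t => z t = k).filter fun t => g t j = true)⟩,
    ⟨_, hlt ((Finset.univ.filter fun t => z t = k).filter fun t => ¬ g t j = true)⟩), ?_⟩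
  intro B hB
  have hfib : ∀ C : Matrix (Fin (nL + 1)) (Fin n) ℝ, lik C z g =
      ∏ j, ∏ k, ∏ t ∈ Finset.univ.filter (fun t => z t = k), bern (C k j) (g t j) := by
    intro C
    unfold lik
    rw [Finset.prod_comm]
    refine Finset.prod_congr rfl fun j _ => ?_
    rw [← Finset.prod_fiberwise Finset.univ z]
    refine Finset.prod_congr rfl fun k _ => Finset.prod_congr rfl fun t ht => ?_
    rw [(Finset.mem_filter.1 ht).2]
  rw [hfib, hfib]
  refine Finset.prod_le_prod
    (fun j _ => Finset.prod_nonneg fun k _ => Finset.prod_nonneg fun t _ => bern_nonneg (hB _ _) _)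
    fun j _ => Finset.prod_le_prod
      (fun k _ => Finset.prod_nonneg fun t _ => bern_nonneg (hB _ _) _) fun k _ => ?_
  rw [prod_bern_eq, prod_bern_eq]
  exact pow_mul_pow_le_freq (hB k j) _ _

/-- The profile value at `z` dominates the likelihood at `(A, z')` and is dominated by the
unconstrained maximum at `z`. -/
lemma IsProfileMLE.lik_le {nL n T : ℕ} {h : nL ≤ n} {g : Fin T → Fin n → Bool}
    {z : Fin T → Fin (nL + 1)} (hz : IsProfileMLE h g z)
    {A : Matrix (Fin (nL + 1)) (Fin n) ℝ} (hA : A ∈ paramSpace h) (z' : Fin T → Fin (nL + 1)) :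
    ∃ c : Fin (nL + 1) → Fin n → Fin (T + 1) × Fin (T + 1),
      lik A z' g ≤ lik (freqMatrix c) z g := by
  obtain ⟨c, hc⟩ := exists_freqMatrix_lik_ge z g
  refine ⟨c, ?_⟩
  have h1 : logLik g A z' ≤ profileLogLik h g z' := le_iSup₂_of_le A hA le_rfl
  have h2 : profileLogLik h g z ≤ logLik g (freqMatrix c) z := by
    refine iSup₂_le fun B hB => ?_
    rw [logLik_eq_log_lik hB.1, logLik_eq_log_lik (freqMatrix_mem_Icc c)]
    exact ENNReal.log_monotone (ENNReal.ofReal_le_ofReal (hc B hB.1))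
  have h3 := h1.trans ((hz z').trans h2)
  rw [logLik_eq_log_lik hA.1, logLik_eq_log_lik (freqMatrix_mem_Icc c),
    ENNReal.log_le_log_iff] at h3
  exact (ENNReal.ofReal_le_ofReal_iff (lik_nonneg (freqMatrix_mem_Icc c) _ _)).1 h3

/-- A maximum profile likelihood estimate only assigns a group to a hub that belongs to it. -/
lemma IsProfileMLE.hub_mem {nL n T : ℕ} {h : nL ≤ n} {g : Fin T → Fin n → Bool}
    {z : Fin T → Fin (nL + 1)} (hz : IsProfileMLE h g z) {t : Fin T} {k : Fin nL}
    (hk : z t = k.succ) : g t (Fin.castLE h k) = true := by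
  by_contra hg
  -- With this matrix the all-null labelling has positive likelihood, so the maximum is not `⊥`; a
  -- group assigned to a hub it lacks would force likelihood zero.
  let B : Matrix (Fin (nL + 1)) (Fin n) ℝ := fun i _ => if i = 0 then 1 / 2 else 1
  have hB : B ∈ paramSpace h := by
    refine ⟨fun i j => ?_, fun i => by simp [B]⟩
    by_cases hi : i = 0 <;> norm_num [B, hi]
  have hpos : 0 < lik B (fun _ => 0) g := by
    refine Finset.prod_pos fun t _ => Finset.prod_pos fun j _ => ?_
    cases g t j <;> norm_num [bern, B]
  have h1 : logLik g B (fun _ => 0) ≤ profileLogLik h g z :=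
    (le_iSup₂_of_le B hB le_rfl : logLik g B (fun _ => 0) ≤ profileLogLik h g _).trans (hz _)
  have h2 : profileLogLik h g z ≤ ⊥ := by
    refine iSup₂_le fun C hC => ?_
    have : lik C z g = 0 := by
      refine Finset.prod_eq_zero (Finset.mem_univ t)
        (Finset.prod_eq_zero (Finset.mem_univ (Fin.castLE h k)) ?_)
      rw [hk, hC.2 k]
      simp [bern, hg]
    rw [logLik_eq_log_lik hC.1, this]
    simp
  have h3 := le_bot_iff.1 (h1.trans h2)
  rw [logLik_eq_log_lik hB.1, ENNReal.log_eq_bot_iff, ENNReal.ofReal_eq_zero] at h3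
  linarith

/-! ### Combinatorics of the table of true and estimated labels -/

/-- If no two rows `i ≠ i'` both have more than `τ` elements in a common estimated class, every
true class has more than `q + (K + 1) τ` elements, and an off-diagonal cell with nonzero column
has at most `q` elements, then every cell `(i, 0)` with `i ≠ 0` has at most `τ` elements. -/
lemma cross_zero_le_of_separated {K : ℕ} (N : Fin (K + 1) → Fin (K + 1) → ℝ) {τ q : ℝ}
    (hτ : 0 ≤ τ) (hq : 0 ≤ q)
    (hsep : ∀ k i i', i ≠ i' → min (N i k) (N i' k) ≤ τ)
    (hrow : ∀ i, q + (K + 1) * τ < ∑ k, N i k)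
    (hoff : ∀ i k, i ≠ k → k ≠ 0 → N i k ≤ q)
    (i : Fin (K + 1)) (hi : i ≠ 0) : N i 0 ≤ τ := by
  have hbig : ∀ i, ∃ k, τ < N i k := by
    intro i
    by_contra! hcon
    have : ∑ k, N i k ≤ ∑ _k : Fin (K + 1), τ := Finset.sum_le_sum fun k _ => hcon k
    simp only [Finset.sum_const, Finset.card_univ, Fintype.card_fin, nsmul_eq_mul] at this
    push_cast at this
    linarith [hrow i]
  choose f hf using hbig
  have huniq : ∀ i i' k, τ < N i k → τ < N i' k → i = i' := by
    intro i i' k h1 h2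
    by_contra hne
    exact absurd (hsep k i i' hne) (not_le.2 (lt_min h1 h2))
  have hinj : Function.Injective f := fun i i' h => huniq i i' (f i) (hf i) (h ▸ hf i')
  -- Every estimated class is now the dominant one of some true class, so by `huniq` no other true
  -- class has a large cell in it.
  have hsurj : Function.Surjective f := Finite.surjective_of_injective hinj
  have hsmall : ∀ i k, k ≠ f i → N i k ≤ τ := by
    intro i k hk
    by_contra! hlt
    obtain ⟨i', rfl⟩ := hsurj k
    exact hk (by rw [huniq i i' _ hlt (hf i')])
  have hmain : ∀ i, q < N i (f i) := by
    intro i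
    have h1 := hrow i
    rw [← Finset.add_sum_erase _ _ (Finset.mem_univ (f i))] at h1
    have h2 : ∑ k ∈ Finset.univ.erase (f i), N i k ≤ ∑ _k ∈ Finset.univ.erase (f i), τ :=
      Finset.sum_le_sum fun k hk => hsmall i k (Finset.ne_of_mem_erase hk)
    simp only [Finset.sum_const, Finset.card_erase_of_mem (Finset.mem_univ _), Finset.card_univ,
      Fintype.card_fin, nsmul_eq_mul, Nat.add_sub_cancel] at h2
    linarith
  have hf' : ∀ i, f i = i ∨ f i = 0 := by
    intro i
    by_contra! hcon
    exact absurd (hoff i (f i) hcon.1.symm hcon.2) (not_le.2 (hmain i))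
  have hf0 : f 0 = 0 := by rcases hf' 0 with h | h <;> exact h
  refine hsmall i 0 fun h => hi (hinj (h.symm.trans hf0.symm))

/-- No `b` is close to both `p` and `q`: `(b - p) ^ 2 + (b - q) ^ 2 ≥ (p - q) ^ 2 / 2`. -/
lemma min_mul_sq_le {x y b p q δ : ℝ} (hx : 0 ≤ x) (hy : 0 ≤ y) (hδ : 0 ≤ δ) (h : δ ≤ p - q) :
    min x y * δ ^ 2 ≤ 2 * (x * (b - p) ^ 2 + y * (b - q) ^ 2) := by
  have hm : 0 ≤ min x y := le_min hx hy
  have h1 : min x y * (b - p) ^ 2 ≤ x * (b - p) ^ 2 :=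
    mul_le_mul_of_nonneg_right (min_le_left _ _) (sq_nonneg _)
  have h2 : min x y * (b - q) ^ 2 ≤ y * (b - q) ^ 2 :=
    mul_le_mul_of_nonneg_right (min_le_right _ _) (sq_nonneg _)
  have h3 : δ ^ 2 ≤ 2 * ((b - p) ^ 2 + (b - q) ^ 2) := by
    have : δ ^ 2 ≤ (p - q) ^ 2 := pow_le_pow_left₀ hδ h 2
    nlinarith [sq_nonneg ((b - p) + (b - q))]
  nlinarith [mul_le_mul_of_nonneg_left h3 hm]

/-- The squared distance between the mean matrices given by `(B, z)` and `(A, ζ)`. -/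
noncomputable def sqDist {nL n T : ℕ} (B : Matrix (Fin (nL + 1)) (Fin n) ℝ)
    (z : Fin T → Fin (nL + 1)) (A : Matrix (Fin (nL + 1)) (Fin n) ℝ)
    (ζ : Fin T → Fin (nL + 1)) : ℝ :=
  ∑ t, ∑ j, (B (z t) j - A (ζ t) j) ^ 2

/-- The cells `(i, k)` and `(i', k)` are disjoint sets of groups fitted by the same row `B k`, so
each column of `V` pays for the smaller one. -/
lemma min_crossCount_mul_le {nL n T : ℕ} {A B : Matrix (Fin (nL + 1)) (Fin n) ℝ}
    {z ζ : Fin T → Fin (nL + 1)} {i i' : Fin (nL + 1)} (hne : i ≠ i') (k : Fin (nL + 1))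
    {V : Finset (Fin n)} {δ : ℝ} (hδ : 0 ≤ δ) (hV : ∀ j ∈ V, δ ≤ A i j - A i' j) :
    min (crossCount ζ z i k : ℝ) (crossCount ζ z i' k) * (V.card * δ ^ 2) ≤
      2 * sqDist B z A ζ := by
  classical
  set x : ℝ := (crossCount ζ z i k : ℝ)
  set y : ℝ := (crossCount ζ z i' k : ℝ)
  have hsum : ∀ j, x * (B k j - A i j) ^ 2 + y * (B k j - A i' j) ^ 2 ≤
      ∑ t, (B (z t) j - A (ζ t) j) ^ 2 := by
    intro j
    have hcell : ∀ a, (crossCount ζ z a k : ℝ) * (B k j - A a j) ^ 2 =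
        ∑ t ∈ Finset.univ.filter (fun t => ζ t = a ∧ z t = k), (B (z t) j - A (ζ t) j) ^ 2 := by
      intro a
      rw [Finset.sum_congr rfl (g := fun _ => (B k j - A a j) ^ 2) fun t ht => by
        obtain ⟨-, h1, h2⟩ := Finset.mem_filter.1 ht
        rw [h1, h2]]
      rw [Finset.sum_const, nsmul_eq_mul, crossCount]
    rw [hcell i, hcell i', ← Finset.sum_union]
    · exact Finset.sum_le_sum_of_subset_of_nonneg (Finset.subset_univ _)
        fun t _ _ => sq_nonneg _
    · rw [Finset.disjoint_filter]
      rintro t - ⟨h1, -⟩ ⟨h2, -⟩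
      exact hne (h1.symm.trans h2)
  calc min x y * (V.card * δ ^ 2) = ∑ j ∈ V, min x y * δ ^ 2 := by
        rw [Finset.sum_const, nsmul_eq_mul]; ring
    _ ≤ ∑ j ∈ V, 2 * ∑ t, (B (z t) j - A (ζ t) j) ^ 2 := by
        refine Finset.sum_le_sum fun j hj => ?_
        exact (min_mul_sq_le (b := B k j) (Nat.cast_nonneg _) (Nat.cast_nonneg _) hδ
          (hV j hj)).trans (mul_le_mul_of_nonneg_left (hsum j) (by norm_num))
    _ ≤ ∑ j, 2 * ∑ t, (B (z t) j - A (ζ t) j) ^ 2 :=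
        Finset.sum_le_sum_of_subset_of_nonneg (Finset.subset_univ _) fun j _ _ => by positivity
    _ = 2 * sqDist B z A ζ := by
        rw [← Finset.mul_sum, Finset.sum_comm, sqDist]

lemma sum_crossCount {nL T : ℕ} (ζ z : Fin T → Fin (nL + 1)) (i : Fin (nL + 1)) :
    ∑ k, crossCount ζ z i k = trueCount ζ i := by
  unfold crossCount trueCount
  rw [Finset.card_eq_sum_card_fiberwise (f := z) (t := Finset.univ) fun _ _ => Finset.mem_univ _]
  refine Finset.sum_congr rfl fun k _ => ?_
  rw [Finset.filter_filter]

/-! ### Sums of products over labels and groups -/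

lemma sum_pi_prod {T : ℕ} {α : Type*} [Fintype α] (f : Fin T → α → ℝ) :
    ∑ x : Fin T → α, ∏ t, f t (x t) = ∏ t, ∑ a, f t a := by
  classical
  rw [Finset.prod_univ_sum, Fintype.piFinset_univ]

lemma sum_sum_pi_prod {T : ℕ} {α β : Type*} [Fintype α] [Fintype β] (f : α → β → ℝ) :
    ∑ z : Fin T → α, ∑ g : Fin T → β, ∏ t, f (z t) (g t) = (∑ a, ∑ b, f a b) ^ T := by
  rw [Finset.sum_congr rfl fun z _ => sum_pi_prod (fun t b => f (z t) b),
    sum_pi_prod (fun _ a => ∑ b, f a b), Finset.prod_const, Finset.card_univ, Fintype.card_fin]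

/-- The probability of a single pair of a label and a group. -/
noncomputable def weight {nL n : ℕ} (ρ : Fin (nL + 1) → ℝ) (A : Matrix (Fin (nL + 1)) (Fin n) ℝ)
    (i : Fin (nL + 1)) (x : Fin n → Bool) : ℝ :=
  ρ i * ∏ j, bern (A i j) (x j)

lemma sum_prod_bern {n : ℕ} (p : Fin n → ℝ) : ∑ x : Fin n → Bool, ∏ j, bern (p j) (x j) = 1 := by
  rw [sum_pi_prod (fun j b => bern (p j) b)]
  exact Finset.prod_eq_one fun j _ => sum_bern (p j)

lemma sum_prod_bern_of_mem {n : ℕ} (p : Fin n → ℝ) (j₀ : Fin n) :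
    ∑ x : Fin n → Bool, (if x j₀ = true then ∏ j, bern (p j) (x j) else 0) = p j₀ := by
  have h : ∀ x : Fin n → Bool, (if x j₀ = true then ∏ j, bern (p j) (x j) else 0) =
      ∏ j, (bern (p j) (x j) * if j = j₀ then (if x j = true then 1 else 0) else 1) := by
    intro x
    rw [Finset.prod_mul_distrib, Finset.prod_ite_eq' Finset.univ j₀]
    simp
  simp_rw [h]
  rw [sum_pi_prod (fun j b => bern (p j) b * if j = j₀ then (if b = true then 1 else 0) else 1),
    Finset.prod_eq_single j₀]
  · simp [bern]
  · intro j _ hj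
    simpa only [if_neg hj, mul_one] using sum_bern (p j)
  · simp

lemma prod_weight {nL n T : ℕ} (ρ : Fin (nL + 1) → ℝ) (A : Matrix (Fin (nL + 1)) (Fin n) ℝ)
    (z : Fin T → Fin (nL + 1)) (g : Fin T → Fin n → Bool) :
    ∏ t, weight ρ A (z t) (g t) = (∏ t, ρ (z t)) * lik A z g :=
  Finset.prod_mul_distrib

/-! ### Union and Chernoff bounds in the hub model -/

section
variable {Ω : Type*} [MeasurableSpace Ω] {μ : Measure Ω} [IsProbabilityMeasure μ]
  {nL n T : ℕ} {ρ : Fin (nL + 1) → ℝ} {A : Matrix (Fin (nL + 1)) (Fin n) ℝ}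
  {zs : Ω → Fin T → Fin (nL + 1)} {G : Ω → Fin T → Fin n → Bool}

/-- Any nonnegative majorant of the law on an event bounds the probability of the event. -/
lemma IsHubNullModel.measure_le (hM : IsHubNullModel μ ρ A zs G)
    (P : (Fin T → Fin (nL + 1)) → (Fin T → Fin n → Bool) → Prop)
    (H : (Fin T → Fin (nL + 1)) → (Fin T → Fin n → Bool) → ℝ) (hH : ∀ z g, 0 ≤ H z g)
    (hPH : ∀ z g, P z g → ∏ t, weight ρ A (z t) (g t) ≤ H z g) :
    μ {ω | P (zs ω) (G ω)} ≤ ENNReal.ofReal (∑ z, ∑ g, H z g) := by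
  classical
  have hcell : ∀ z g, P z g → μ {ω | zs ω = z ∧ G ω = g} ≤ ENNReal.ofReal (H z g) := by
    intro z g h
    rw [← ofReal_measureReal (measure_ne_top _ _), hM.law]
    exact ENNReal.ofReal_le_ofReal (hPH z g h)
  calc μ {ω | P (zs ω) (G ω)}
      ≤ μ (⋃ p ∈ (Finset.univ.filter fun p : (Fin T → Fin (nL + 1)) × (Fin T → Fin n → Bool) =>
          P p.1 p.2), {ω | zs ω = p.1 ∧ G ω = p.2}) := by
        refine measure_mono fun ω hω => ?_
        simp only [Set.mem_iUnion]
        exact ⟨(zs ω, G ω), by simpa using hω, rfl, rfl⟩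
    _ ≤ ∑ p ∈ (Finset.univ.filter fun p : (Fin T → Fin (nL + 1)) × (Fin T → Fin n → Bool) =>
          P p.1 p.2), μ {ω | zs ω = p.1 ∧ G ω = p.2} := measure_biUnion_finset_le _ _
    _ ≤ ∑ p ∈ (Finset.univ.filter fun p : (Fin T → Fin (nL + 1)) × (Fin T → Fin n → Bool) =>
          P p.1 p.2), ENNReal.ofReal (H p.1 p.2) :=
        Finset.sum_le_sum fun p hp => hcell _ _ (Finset.mem_filter.1 hp).2
    _ ≤ ∑ p : (Fin T → Fin (nL + 1)) × (Fin T → Fin n → Bool), ENNReal.ofReal (H p.1 p.2) :=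
        Finset.sum_le_sum_of_subset (Finset.subset_univ _)
    _ = ENNReal.ofReal (∑ z, ∑ g, H z g) := by
        rw [← ENNReal.ofReal_sum_of_nonneg fun p _ => hH _ _, Fintype.sum_prod_type]

lemma weight_nonneg (hρ : ∀ i, 0 ≤ ρ i) (hA : ∀ i j, A i j ∈ Set.Icc (0 : ℝ) 1)
    (i : Fin (nL + 1)) (x : Fin n → Bool) : 0 ≤ weight ρ A i x :=
  mul_nonneg (hρ i) (Finset.prod_nonneg fun _ _ => bern_nonneg (hA _ _) _)

/-- An exponential Markov inequality for the number of observations in a given set. -/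
lemma IsHubNullModel.chernoff (hM : IsHubNullModel μ ρ A zs G) (hρ0 : ∀ i, 0 ≤ ρ i)
    (hρ : ∑ i, ρ i = 1) (hA : ∀ i j, A i j ∈ Set.Icc (0 : ℝ) 1)
    (D : Fin (nL + 1) → (Fin n → Bool) → Prop) [∀ i x, Decidable (D i x)] {p : ℝ}
    (hp : ∑ i, ∑ x, (if D i x then weight ρ A i x else 0) = p) (s a : ℝ) :
    μ {ω | s * a ≤ s * ((Finset.univ.filter fun t => D (zs ω t) (G ω t)).card : ℝ)} ≤
      ENNReal.ofReal (Real.exp (T * (p * (Real.exp s - 1)) - s * a)) := by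
  have hw := weight_nonneg (n := n) (A := A) hρ0 hA
  -- Exponentially tilted weights, of total mass `1 + p * (exp s - 1)`. Since `s` multiplies both
  -- sides of the event, its sign selects the upper or the lower tail.
  set F : Fin (nL + 1) → (Fin n → Bool) → ℝ :=
    fun i x => weight ρ A i x * if D i x then Real.exp s else 1 with hF
  have hF0 : ∀ i x, 0 ≤ F i x := fun i x =>
    mul_nonneg (hw i x) (by split_ifs <;> positivity)
  refine (hM.measure_le
    (fun z g => s * a ≤ s * ((Finset.univ.filter fun t => D (z t) (g t)).card : ℝ))
    (fun z g => Real.exp (-(s * a)) * ∏ t, F (z t) (g t))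
    (fun z g => mul_nonneg (Real.exp_nonneg _) (Finset.prod_nonneg fun t _ => hF0 _ _)) ?_).trans ?_
  · intro z g h
    have hprod : ∏ t, F (z t) (g t) = (∏ t, weight ρ A (z t) (g t)) *
        Real.exp (s * ((Finset.univ.filter fun t => D (z t) (g t)).card : ℝ)) := by
      rw [Finset.prod_mul_distrib, Finset.prod_ite, Finset.prod_const, Finset.prod_const_one,
        mul_one, ← Real.exp_nat_mul, mul_comm s]
    rw [hprod, mul_left_comm, ← Real.exp_add]
    refine le_mul_of_one_le_right (Finset.prod_nonneg fun t _ => hw _ _) ?_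
    exact Real.one_le_exp (by linarith)
  · refine ENNReal.ofReal_le_ofReal ?_
    simp_rw [← Finset.mul_sum]
    rw [sum_sum_pi_prod F]
    have htot : ∑ i, ∑ x, weight ρ A i x = 1 := by
      simp_rw [weight, ← Finset.mul_sum, sum_prod_bern, mul_one, hρ]
    have hsum : ∑ i, ∑ x, F i x = 1 + p * (Real.exp s - 1) := by
      rw [← hp, Finset.sum_mul]
      nth_rewrite 1 [← htot]
      rw [← Finset.sum_add_distrib]
      refine Finset.sum_congr rfl fun i _ => ?_
      rw [Finset.sum_mul, ← Finset.sum_add_distrib]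
      refine Finset.sum_congr rfl fun x _ => ?_
      simp only [hF]
      split_ifs <;> ring
    have hnn : 0 ≤ 1 + p * (Real.exp s - 1) := by
      rw [← hsum]
      exact Finset.sum_nonneg fun i _ => Finset.sum_nonneg fun x _ => hF0 i x
    have hle : 1 + p * (Real.exp s - 1) ≤ Real.exp (p * (Real.exp s - 1)) := by
      linarith [Real.add_one_le_exp (p * (Real.exp s - 1))]
    rw [hsum]
    calc Real.exp (-(s * a)) * (1 + p * (Real.exp s - 1)) ^ T
        ≤ Real.exp (-(s * a)) * Real.exp (p * (Real.exp s - 1)) ^ T := by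
          gcongr
      _ = _ := by
          rw [← Real.exp_nat_mul, ← Real.exp_add]
          congr 1
          ring

end

/-! ### Hellinger affinity and the likelihood comparison -/

/-- The Hellinger affinity of two Bernoulli laws. -/
lemma sum_sqrt_bern_le {p q : ℝ} (hp : p ∈ Set.Icc (0 : ℝ) 1) (hq : q ∈ Set.Icc (0 : ℝ) 1) :
    ∑ b, √(bern p b * bern q b) ≤ Real.exp (-((q - p) ^ 2 / 4)) := by
  have hp' : 0 ≤ 1 - p := by linarith [hp.2]
  have hq' : 0 ≤ 1 - q := by linarith [hq.2]
  -- The gap `(x + y) / 2 - √(x * y)` is `(√x - √y) ^ 2 / 2`, while `(x - y) ^ 2 = (√x - √y) ^ 2 *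
  -- (√x + √y) ^ 2` with last factor at most `4`.
  have key : ∀ x y : ℝ, x ∈ Set.Icc (0 : ℝ) 1 → y ∈ Set.Icc (0 : ℝ) 1 →
      √(x * y) ≤ (x + y) / 2 - (x - y) ^ 2 / 8 := by
    intro x y hx hy
    rw [Real.sqrt_mul hx.1]
    obtain ⟨ha, hb⟩ := And.intro (Real.sqrt_nonneg x) (Real.sqrt_nonneg y)
    have ha1 : √x ≤ 1 := Real.sqrt_le_one.2 hx.2
    have hb1 : √y ≤ 1 := Real.sqrt_le_one.2 hy.2
    have hxs := Real.sq_sqrt hx.1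
    have hys := Real.sq_sqrt hy.1
    set a := √x
    set b := √y
    rw [← hxs, ← hys]
    have h1 : (a + b) ^ 2 ≤ 4 := by nlinarith
    nlinarith [mul_le_mul_of_nonneg_left h1 (sq_nonneg (a - b))]
  have h1 := key p q hp hq
  have h2 := key (1 - p) (1 - q) ⟨hp', by linarith [hp.1]⟩ ⟨hq', by linarith [hq.1]⟩
  have h3 := Real.add_one_le_exp (-((q - p) ^ 2 / 4))
  simp only [Fintype.sum_bool, bern, if_true, Bool.false_eq_true, if_false]
  nlinarith

lemma sum_sqrt_lik_le {nL n T : ℕ} {A B : Matrix (Fin (nL + 1)) (Fin n) ℝ}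
    (hA : ∀ i j, A i j ∈ Set.Icc (0 : ℝ) 1) (hB : ∀ i j, B i j ∈ Set.Icc (0 : ℝ) 1)
    (ζ z : Fin T → Fin (nL + 1)) :
    ∑ g, √(lik A ζ g * lik B z g) ≤ Real.exp (-(sqDist B z A ζ / 4)) := by
  have h1 : ∀ g : Fin T → Fin n → Bool, √(lik A ζ g * lik B z g) =
      ∏ t, ∏ j, √(bern (A (ζ t) j) (g t j) * bern (B (z t) j) (g t j)) := by
    intro g
    unfold lik
    rw [← Finset.prod_mul_distrib, Real.sqrt_prod _ fun t _ => mul_nonneg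
      (Finset.prod_nonneg fun _ _ => bern_nonneg (hA _ _) _)
      (Finset.prod_nonneg fun _ _ => bern_nonneg (hB _ _) _)]
    refine Finset.prod_congr rfl fun t _ => ?_
    rw [← Finset.prod_mul_distrib, Real.sqrt_prod _ fun j _ => mul_nonneg
      (bern_nonneg (hA _ _) _) (bern_nonneg (hB _ _) _)]
  simp_rw [h1]
  rw [sum_pi_prod (fun t (x : Fin n → Bool) =>
    ∏ j, √(bern (A (ζ t) j) (x j) * bern (B (z t) j) (x j)))]
  have h2 : ∀ t, ∑ x : Fin n → Bool, ∏ j, √(bern (A (ζ t) j) (x j) * bern (B (z t) j) (x j)) ≤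
      Real.exp (-(∑ j, (B (z t) j - A (ζ t) j) ^ 2) / 4) := by
    intro t
    rw [sum_pi_prod (fun j b => √(bern (A (ζ t) j) b * bern (B (z t) j) b))]
    calc ∏ j, ∑ b, √(bern (A (ζ t) j) b * bern (B (z t) j) b)
        ≤ ∏ j, Real.exp (-((B (z t) j - A (ζ t) j) ^ 2 / 4)) :=
          Finset.prod_le_prod (fun j _ => Finset.sum_nonneg fun b _ => Real.sqrt_nonneg _)
            fun j _ => sum_sqrt_bern_le (hA _ _) (hB _ _)
      _ = _ := by
          rw [← Real.exp_sum, Finset.sum_neg_distrib, ← Finset.sum_div, neg_div]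
  refine (Finset.prod_le_prod (fun t _ => Finset.sum_nonneg fun x _ =>
    Finset.prod_nonneg fun j _ => Real.sqrt_nonneg _) fun t _ => h2 t).trans ?_
  rw [← Real.exp_sum, ← Finset.sum_div, Finset.sum_neg_distrib, neg_div, sqDist]

/-- With high probability, only parameters close to the truth can have a larger likelihood. -/
lemma IsHubNullModel.measure_lik_le {Ω : Type*} [MeasurableSpace Ω] {μ : Measure Ω}
    [IsProbabilityMeasure μ] {nL n T : ℕ} {ρ : Fin (nL + 1) → ℝ}
    {A : Matrix (Fin (nL + 1)) (Fin n) ℝ}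
    {zs : Ω → Fin T → Fin (nL + 1)} {G : Ω → Fin T → Fin n → Bool}
    (hM : IsHubNullModel μ ρ A zs G) (hρ0 : ∀ i, 0 ≤ ρ i)
    (hρ : ∑ i, ρ i = 1) (hA : ∀ i j, A i j ∈ Set.Icc (0 : ℝ) 1) (R : ℝ) :
    μ {ω | ∃ (z : Fin T → Fin (nL + 1)) (c : Fin (nL + 1) → Fin n → Fin (T + 1) × Fin (T + 1)),
        R < sqDist (freqMatrix c) z A (zs ω) ∧ lik A (zs ω) (G ω) ≤ lik (freqMatrix c) z (G ω)} ≤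
      ENNReal.ofReal (Real.exp (T * Real.log (nL + 1) + 2 * (nL + 1) * n * Real.log (T + 1) -
        R / 4)) := by
  classical
  have hρp : ∀ z : Fin T → Fin (nL + 1), 0 ≤ ∏ t, ρ (z t) := fun z =>
    Finset.prod_nonneg fun t _ => hρ0 _
  set X := (Fin T → Fin (nL + 1)) × (Fin (nL + 1) → Fin n → Fin (T + 1) × Fin (T + 1))
  -- If the truth has the smaller likelihood, it is at most the geometric mean of the two; summed
  -- over `g`, that mean is the affinity.
  set H : (Fin T → Fin (nL + 1)) → X → (Fin T → Fin n → Bool) → ℝ := fun ζ x g =>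
    if R < sqDist (freqMatrix x.2) x.1 A ζ then √(lik A ζ g * lik (freqMatrix x.2) x.1 g) else 0
    with hH
  have hH0 : ∀ ζ x g, 0 ≤ H ζ x g := by
    intro ζ x g
    simp only [hH]
    split_ifs
    · exact Real.sqrt_nonneg _
    · exact le_rfl
  refine (hM.measure_le (fun ζ g => ∃ (z : Fin T → Fin (nL + 1))
      (c : Fin (nL + 1) → Fin n → Fin (T + 1) × Fin (T + 1)),
        R < sqDist (freqMatrix c) z A ζ ∧ lik A ζ g ≤ lik (freqMatrix c) z g)
    (fun ζ g => (∏ t, ρ (ζ t)) * ∑ x, H ζ x g)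
    (fun ζ g => mul_nonneg (hρp ζ) (Finset.sum_nonneg fun x _ => hH0 _ _ _)) ?_).trans ?_
  · rintro ζ g ⟨z, c, hR, hl⟩
    rw [prod_weight]
    refine mul_le_mul_of_nonneg_left ?_ (hρp ζ)
    have h0 : 0 ≤ lik A ζ g := lik_nonneg hA _ _
    calc lik A ζ g ≤ H ζ (z, c) g := by
          simp only [hH, if_pos hR]
          exact Real.le_sqrt_of_sq_le (by nlinarith)
      _ ≤ _ := Finset.single_le_sum (f := fun x => H ζ x g) (fun x _ => hH0 _ _ _)
          (Finset.mem_univ _)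
  · refine ENNReal.ofReal_le_ofReal ?_
    have hx : ∀ ζ x, ∑ g, H ζ x g ≤ Real.exp (-(R / 4)) := by
      intro ζ x
      simp only [hH]
      split_ifs with h
      · refine (sum_sqrt_lik_le hA (freqMatrix_mem_Icc x.2) ζ x.1).trans (Real.exp_le_exp.2 ?_)
        linarith
      · simp [Real.exp_nonneg]
    -- The entropy of the union bound: `nL + 1` choices per group and `(T + 1) ^ 2` per matrix
    -- entry.
    have hcard : (Fintype.card X : ℝ) =
        Real.exp (T * Real.log (nL + 1) + 2 * (nL + 1) * n * Real.log (T + 1)) := by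
      have e1 : ((nL : ℝ) + 1) ^ T = Real.exp (T * Real.log (nL + 1)) := by
        rw [Real.exp_nat_mul, Real.exp_log (by positivity)]
      have e2 : ((T : ℝ) + 1) ^ (2 * (nL + 1) * n) =
          Real.exp (2 * (nL + 1) * n * Real.log (T + 1)) := by
        rw [show (2 * ((nL : ℝ) + 1) * n) = ((2 * (nL + 1) * n : ℕ) : ℝ) by push_cast; ring,
          Real.exp_nat_mul, Real.exp_log (by positivity)]
      rw [Real.exp_add, ← e1, ← e2]
      simp only [X, Fintype.card_prod, Fintype.card_pi, Fintype.card_fin, Finset.prod_const,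
        Finset.card_univ]
      push_cast
      rw [← pow_two, ← pow_mul, ← pow_mul]
      congr 2
      ring
    have hζ : ∀ ζ : Fin T → Fin (nL + 1), ∑ g, (∏ t, ρ (ζ t)) * ∑ x, H ζ x g ≤
        (∏ t, ρ (ζ t)) * (Fintype.card X * Real.exp (-(R / 4))) := by
      intro ζ
      rw [← Finset.mul_sum, Finset.sum_comm]
      refine mul_le_mul_of_nonneg_left ?_ (hρp ζ)
      refine (Finset.sum_le_sum fun x _ => hx ζ x).trans ?_
      rw [Finset.sum_const, Finset.card_univ, nsmul_eq_mul]
    refine (Finset.sum_le_sum fun ζ _ => hζ ζ).trans ?_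
    rw [← Finset.sum_mul, sum_pi_prod (fun _ i => ρ i), hρ, Finset.prod_const_one, one_mul, hcard,
      ← Real.exp_add, sub_eq_add_neg]

/-! ### Finite-sample bound -/

section
variable {Ω : Type*} [MeasurableSpace Ω] {μ : Measure Ω} [IsProbabilityMeasure μ]
  {nL n T : ℕ} {ρ : Fin (nL + 1) → ℝ} {A : Matrix (Fin (nL + 1)) (Fin n) ℝ}
  {zs : Ω → Fin T → Fin (nL + 1)} {G : Ω → Fin T → Fin n → Bool}

lemma IsHubNullModel.measure_trueCount_le (hM : IsHubNullModel μ ρ A zs G) (hρ0 : ∀ i, 0 ≤ ρ i)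
    (hρ : ∑ i, ρ i = 1) (hA : ∀ i j, A i j ∈ Set.Icc (0 : ℝ) 1) {a : ℝ} {i : Fin (nL + 1)}
    (ha : a ≤ T * ρ i) :
    μ {ω | (trueCount (zs ω) i : ℝ) ≤ a / 2} ≤ ENNReal.ofReal (Real.exp (-(a / 10))) := by
  have hp : ∑ i', ∑ x : Fin n → Bool, (if i' = i then weight ρ A i' x else 0) = ρ i := by
    rw [Finset.sum_comm]
    simp [weight, ← Finset.mul_sum, sum_prod_bern]
  refine (measure_mono fun ω hω => ?_).trans
    ((hM.chernoff hρ0 hρ hA (fun i' _ => i' = i) hp (-1) (a / 2)).trans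
      (ENNReal.ofReal_le_ofReal (Real.exp_le_exp.2 ?_)))
  · have h : (trueCount (zs ω) i : ℝ) ≤ a / 2 := hω
    simp only [trueCount] at h
    change -1 * (a / 2) ≤ -1 * _
    linarith
  · have h1 : Real.exp (-1) ≤ 2 / 5 := by
      rw [Real.exp_neg, inv_le_comm₀ (Real.exp_pos _) (by norm_num)]
      linarith [Real.exp_one_gt_d9]
    have h2 : 0 ≤ T * ρ i := mul_nonneg (Nat.cast_nonneg _) (hρ0 i)
    nlinarith

lemma IsHubNullModel.measure_cross_ge (hM : IsHubNullModel μ ρ A zs G) (hρ0 : ∀ i, 0 ≤ ρ i)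
    (hρ : ∑ i, ρ i = 1) (hA : ∀ i j, A i j ∈ Set.Icc (0 : ℝ) 1) {a : ℝ} (ha0 : 0 ≤ a)
    {i : Fin (nL + 1)} {j : Fin n} (ha : T * (ρ i * A i j) ≤ a / 16) :
    μ {ω | a / 4 ≤
        ((Finset.univ.filter fun t => zs ω t = i ∧ G ω t j = true).card : ℝ)} ≤
      ENNReal.ofReal (Real.exp (-(a / 10))) := by
  have hp : ∑ i', ∑ x : Fin n → Bool,
      (if i' = i ∧ x j = true then weight ρ A i' x else 0) = ρ i * A i j := by
    rw [Finset.sum_eq_single i (fun b _ hb => by simp [hb]) (by simp),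
      ← sum_prod_bern_of_mem (A i) j, Finset.mul_sum]
    refine Finset.sum_congr rfl fun x _ => ?_
    simp only [true_and, weight, mul_ite, mul_zero]
  refine (measure_mono fun ω hω => ?_).trans
    ((hM.chernoff hρ0 hρ hA (fun i' x => i' = i ∧ x j = true) hp 1 (a / 4)).trans
      (ENNReal.ofReal_le_ofReal (Real.exp_le_exp.2 ?_)))
  · simp only [one_mul]
    exact hω
  · have h1 := Real.exp_one_lt_d9
    have h2 : 0 ≤ T * (ρ i * A i j) := mul_nonneg (Nat.cast_nonneg _)
      (mul_nonneg (hρ0 i) (hA i j).1)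
    nlinarith

lemma crossCount_zero_le {h : nL ≤ n} {g : Fin T → Fin n → Bool} {ζ z : Fin T → Fin (nL + 1)}
    (hA : A ∈ paramSpace h) {V : Fin nL → Finset (Fin n)} {δ W τ R a : ℝ} (hδ : 0 < δ)
    (hW : 0 < W) (hV : ∀ i, W ≤ (V i).card)
    (hVsep : ∀ (i : Fin nL) (i' : Fin (nL + 1)), i' ≠ i.succ → ∀ j ∈ V i, δ ≤ A i.succ j - A i' j)
    (hτ : 0 ≤ τ) (ha : 0 ≤ a) (hτa : (nL + 1) * τ ≤ a / 4) (hR : 2 * R ≤ τ * (W * δ ^ 2))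
    (hz : IsProfileMLE h g z)
    (htrue : ∀ i, a / 2 < trueCount ζ i)
    (hcross : ∀ (i : Fin (nL + 1)) (k : Fin nL), i ≠ k.succ →
      ((Finset.univ.filter fun t => ζ t = i ∧ g t (Fin.castLE h k) = true).card : ℝ) < a / 4)
    (hlik : ∀ (z : Fin T → Fin (nL + 1)) (c : Fin (nL + 1) → Fin n → Fin (T + 1) × Fin (T + 1)),
      lik A ζ g ≤ lik (freqMatrix c) z g → sqDist (freqMatrix c) z A ζ ≤ R)
    (i : Fin nL) : (crossCount ζ z i.succ 0 : ℝ) ≤ τ := by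
  obtain ⟨c, hc⟩ := hz.lik_le hA ζ
  have hS := hlik z c hc
  have hsep : ∀ (k : Fin (nL + 1)) (i : Fin nL) (i' : Fin (nL + 1)), i.succ ≠ i' →
      min (crossCount ζ z i.succ k : ℝ) (crossCount ζ z i' k) ≤ τ := by
    intro k i i' hne
    have h1 := min_crossCount_mul_le (B := freqMatrix c) (z := z) (ζ := ζ) hne k hδ.le
      (hVsep i i' hne.symm)
    have h2 : 0 ≤ min (crossCount ζ z i.succ k : ℝ) (crossCount ζ z i' k) :=
      le_min (Nat.cast_nonneg _) (Nat.cast_nonneg _)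
    have h3 : W * δ ^ 2 ≤ (V i).card * δ ^ 2 := by gcongr; exact hV i
    have h4 : 0 < W * δ ^ 2 := by positivity
    refine le_of_mul_le_mul_right ?_ h4
    calc _ ≤ _ := mul_le_mul_of_nonneg_left h3 h2
      _ ≤ _ := h1
      _ ≤ _ := by linarith
  refine cross_zero_le_of_separated (fun i k => (crossCount ζ z i k : ℝ)) (q := a / 4) hτ
    (by positivity) ?_ ?_ ?_ i.succ (Fin.succ_ne_zero i)
  -- Condition (i) separates only hub rows from the others, but of two distinct labels at least one
  -- is a hub.
  · intro k i i' hne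
    induction i using Fin.cases with
    | succ i => exact hsep k i i' hne
    | zero =>
      induction i' using Fin.cases with
      | succ i' =>
        rw [min_comm]
        exact hsep k i' 0 hne.symm
      | zero => exact absurd rfl hne
  · intro i
    have h1 : ∑ k, (crossCount ζ z i k : ℝ) = trueCount ζ i := by
      exact_mod_cast sum_crossCount ζ z i
    rw [h1]
    linarith [htrue i]
  · intro i k hik hk
    obtain ⟨k, rfl⟩ := Fin.exists_succ_eq.2 hk
    refine le_trans ?_ (hcross i k hik).le
    rw [crossCount]
    refine Nat.cast_le.2 (Finset.card_le_card fun t ht => ?_)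
    obtain ⟨-, h1, h2⟩ := Finset.mem_filter.1 ht
    exact Finset.mem_filter.2 ⟨Finset.mem_univ t, h1, hz.hub_mem h2⟩

/-- A finite-sample version of the consistency of the maximum profile likelihood estimate. -/
lemma IsHubNullModel.measure_compl_le (hM : IsHubNullModel μ ρ A zs G) (hρ0 : ∀ i, 0 ≤ ρ i)
    (hρ : ∑ i, ρ i = 1) {h : nL ≤ n} (hA : A ∈ paramSpace h)
    {V : Fin nL → Finset (Fin n)} {δ W τ R a : ℝ} (hδ : 0 < δ)
    (hW : 0 < W) (hV : ∀ i, W ≤ (V i).card)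
    (hVsep : ∀ (i : Fin nL) (i' : Fin (nL + 1)), i' ≠ i.succ → ∀ j ∈ V i, δ ≤ A i.succ j - A i' j)
    (hτ : 0 ≤ τ) (ha : 0 ≤ a) (hτa : (nL + 1) * τ ≤ a / 4) (hR : 2 * R ≤ τ * (W * δ ^ 2))
    (haρ : ∀ i, a ≤ T * ρ i)
    (haA : ∀ (i : Fin (nL + 1)) (k : Fin nL), i ≠ k.succ →
      T * (ρ i * A i (Fin.castLE h k)) ≤ a / 16)
    {zhat : Ω → Fin T → Fin (nL + 1)} (hz : ∀ᵐ ω ∂μ, IsProfileMLE h (G ω) (zhat ω)) :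
    μ {ω | ∀ i : Fin nL, a / 2 < trueCount (zs ω) i.succ ∧
        (crossCount (zs ω) (zhat ω) i.succ 0 : ℝ) ≤ τ}ᶜ ≤
      ENNReal.ofReal ((nL + 1) ^ 2 * Real.exp (-(a / 10)) +
        Real.exp (T * Real.log (nL + 1) + 2 * (nL + 1) * n * Real.log (T + 1) - R / 4)) := by
  classical
  set E₀ := {ω | ¬ IsProfileMLE h (G ω) (zhat ω)}
  set E₁ : Fin (nL + 1) → Set Ω := fun i => {ω | (trueCount (zs ω) i : ℝ) ≤ a / 2}
  -- Diagonal pairs are discarded, since a hub belongs to all its own groups.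
  set E₂ : Fin (nL + 1) × Fin nL → Set Ω := fun p => if p.1 = p.2.succ then ∅ else
    {ω | a / 4 ≤ ((Finset.univ.filter fun t =>
      zs ω t = p.1 ∧ G ω t (Fin.castLE h p.2) = true).card : ℝ)}
  set E₃ := {ω | ∃ (z : Fin T → Fin (nL + 1))
    (c : Fin (nL + 1) → Fin n → Fin (T + 1) × Fin (T + 1)),
    R < sqDist (freqMatrix c) z A (zs ω) ∧ lik A (zs ω) (G ω) ≤ lik (freqMatrix c) z (G ω)}
  have hsub : {ω | ∀ i : Fin nL, a / 2 < trueCount (zs ω) i.succ ∧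
      (crossCount (zs ω) (zhat ω) i.succ 0 : ℝ) ≤ τ}ᶜ ⊆
      ((E₀ ∪ ⋃ i, E₁ i) ∪ ⋃ p, E₂ p) ∪ E₃ := by
    refine Set.compl_subset_comm.1 fun ω hω => ?_
    simp only [Set.mem_compl_iff, Set.mem_union, Set.mem_iUnion, not_or, not_exists] at hω
    obtain ⟨⟨⟨h0, h1⟩, h2⟩, h3⟩ := hω
    have h0' : IsProfileMLE h (G ω) (zhat ω) := not_not.1 h0
    have h1' : ∀ i, a / 2 < trueCount (zs ω) i := fun i => not_le.1 (h1 i)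
    refine fun i => ⟨h1' _, crossCount_zero_le hA hδ hW hV hVsep hτ ha hτa hR h0' h1' ?_ ?_ i⟩
    · intro i k hik
      have := h2 (i, k)
      simp only [E₂, if_neg hik] at this
      exact not_le.1 this
    · intro z c hl
      by_contra! hlt
      exact h3 ⟨z, c, hlt, hl⟩
  have b0 : μ E₀ = 0 := hz
  have b1 : ∀ i, μ (E₁ i) ≤ ENNReal.ofReal (Real.exp (-(a / 10))) := fun i =>
    hM.measure_trueCount_le hρ0 hρ hA.1 (haρ i)
  have b2 : ∀ p, μ (E₂ p) ≤ ENNReal.ofReal (Real.exp (-(a / 10))) := by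
    intro p
    simp only [E₂]
    split_ifs with hp
    · simp
    · exact hM.measure_cross_ge hρ0 hρ hA.1 ha (haA _ _ hp)
  have b3 := hM.measure_lik_le hρ0 hρ hA.1 R
  have u1 : μ (⋃ i, E₁ i) ≤ (nL + 1 : ℕ) * ENNReal.ofReal (Real.exp (-(a / 10))) := by
    refine (measure_iUnion_fintype_le _ _).trans ((Finset.sum_le_sum fun i _ => b1 i).trans ?_)
    simp
  have u2 : μ (⋃ p, E₂ p) ≤ ((nL + 1) * nL : ℕ) * ENNReal.ofReal (Real.exp (-(a / 10))) := by
    refine (measure_iUnion_fintype_le _ _).trans ((Finset.sum_le_sum fun i _ => b2 i).trans ?_)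
    simp
  calc _ ≤ _ := measure_mono hsub
    _ ≤ ((0 + (nL + 1 : ℕ) * ENNReal.ofReal (Real.exp (-(a / 10)))) +
        ((nL + 1) * nL : ℕ) * ENNReal.ofReal (Real.exp (-(a / 10)))) +
        ENNReal.ofReal (Real.exp (T * Real.log (nL + 1) +
          2 * (nL + 1) * n * Real.log (T + 1) - R / 4)) := by
        refine (measure_union_le _ _).trans (add_le_add ((measure_union_le _ _).trans
          (add_le_add ((measure_union_le _ _).trans (add_le_add b0.le u1)) u2)) b3)
    _ = _ := by
        -- The two families of Chernoff events number `(nL + 1) + (nL + 1) * nL = (nL + 1) ^ 2`.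
        rw [zero_add, ← add_mul, ← ENNReal.ofReal_natCast, ← ENNReal.ofReal_natCast,
          ← ENNReal.ofReal_add (by positivity) (by positivity),
          ← ENNReal.ofReal_mul (by positivity),
          ← ENNReal.ofReal_add (by positivity) (by positivity)]
        congr 3
        push_cast
        ring

end

/-! ### Rates and the limit -/

/-- The rate conditions make both error terms of the finite-sample bound at most `1 / (L + 1)`. -/
lemma error_bound_le {L n T d v c κ : ℝ} (hL : 2 ≤ L) (hn : 1 ≤ n) (hT : 2 ≤ T) (hd : 0 < d)
    (hd1 : d ≤ 1) (hv : 0 < v) (hvL : v ≤ L) (hκ : 0 < κ)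
    (h1 : L ^ 2 * Real.log L / T < c / 60)
    (h2 : L ^ 5 * Real.log T / (d ^ 2 * v * T) < κ / 512)
    (h3 : L ^ 8 * Real.log L / (d ^ 4 * v ^ 2 * n) < κ / 128) :
    (L + 1) ^ 2 * Real.exp (-(c * T / L / 10)) +
      Real.exp (T * Real.log (L + 1) + 2 * (L + 1) * n * Real.log (T + 1) -
        (κ * T / L / (L + 1) * (v * n / L * d ^ 2) / 2) / 4) ≤ 2 / (L + 1) := by
  have hL0 : 0 < L := by linarith
  have hT0 : 0 < T := by linarith
  have hn0 : 0 < n := by linarith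
  have hlog1 : ∀ x : ℝ, 2 ≤ x → Real.log (x + 1) ≤ 2 * Real.log x := by
    intro x hx
    rw [show 2 * Real.log x = Real.log (x ^ 2) by rw [Real.log_pow]; norm_num]
    exact Real.log_le_log (by linarith) (by nlinarith)
  have hlL : 0 ≤ Real.log L := Real.log_nonneg (by linarith)
  have hlT : 0 ≤ Real.log T := Real.log_nonneg (by linarith)
  have hlL1 : 0 ≤ Real.log (L + 1) := Real.log_nonneg (by linarith)
  rw [div_lt_iff₀ (by positivity)] at h1 h2 h3
  have f1 : Real.exp (-(c * T / L / 10)) ≤ 1 / (L + 1) ^ 3 := by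
    have hx : 3 * Real.log (L + 1) ≤ c * T / L / 10 := by
      rw [div_div, le_div_iff₀ (by positivity)]
      have : L * Real.log L ≤ L ^ 2 * Real.log L :=
        mul_le_mul_of_nonneg_right (by nlinarith) hlL
      nlinarith [hlog1 L hL]
    calc Real.exp (-(c * T / L / 10)) ≤ Real.exp (-(3 * Real.log (L + 1))) :=
          Real.exp_le_exp.2 (neg_le_neg hx)
      _ = 1 / (L + 1) ^ 3 := by
          rw [Real.exp_neg, show 3 * Real.log (L + 1) = Real.log ((L + 1) ^ 3) by
            rw [Real.log_pow]; norm_num, Real.exp_log (by positivity), one_div]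
  -- The gain is at least `4 * S`, by `L + 1 ≤ 2 * L`. Each entropy term costs at most `S`, and the
  -- remaining `2 * S` exceeds `log (L + 1)`.
  set S := κ * T * (v * n * d ^ 2) / (64 * L ^ 3) with hS
  have hR : 4 * S ≤ (κ * T / L / (L + 1) * (v * n / L * d ^ 2) / 2) / 4 := by
    have e1 : (κ * T / L / (L + 1) * (v * n / L * d ^ 2) / 2) / 4 =
        κ * T * (v * n * d ^ 2) / (8 * L ^ 2 * (L + 1)) := by
      field_simp; norm_num
    have e2 : 4 * S = κ * T * (v * n * d ^ 2) / (16 * L ^ 3) := by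
      rw [hS]; field_simp; norm_num
    rw [e1, e2]
    refine div_le_div_of_nonneg_left (by positivity) (by positivity) ?_
    nlinarith [sq_nonneg L, mul_nonneg (sq_nonneg L) (by linarith : (0 : ℝ) ≤ L - 1)]
  have g1 : T * Real.log (L + 1) ≤ S := by
    have k1 : L ^ 3 * Real.log L ≤ L ^ 7 * Real.log L :=
      mul_le_mul_of_nonneg_right (pow_le_pow_right₀ (by linarith) (by norm_num)) hlL
    have k2 : L ^ 7 * Real.log L ≤ κ / 128 * (d ^ 2 * v * n) := by
      refine le_of_mul_le_mul_right ?_ hL0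
      -- One factor `L` is traded for `d ^ 2 * v`, because the gain contains only the first power of
      -- `d ^ 2 * v`.
      have k3 : d ^ 4 * v ^ 2 * n ≤ d ^ 2 * v * n * L := by
        have : d ^ 2 * v ≤ 1 * L := mul_le_mul (pow_le_one₀ hd.le hd1) hvL hv.le (by norm_num)
        calc d ^ 4 * v ^ 2 * n = (d ^ 2 * v * n) * (d ^ 2 * v) := by ring
          _ ≤ (d ^ 2 * v * n) * (1 * L) := mul_le_mul_of_nonneg_left this (by positivity)
          _ = _ := by ring
      have k4 := mul_le_mul_of_nonneg_left k3 (by positivity : 0 ≤ κ / 128)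
      calc L ^ 7 * Real.log L * L = L ^ 8 * Real.log L := by ring
        _ ≤ _ := h3.le
        _ ≤ _ := k4
        _ = _ := by ring
    rw [hS, le_div_iff₀ (by positivity)]
    calc T * Real.log (L + 1) * (64 * L ^ 3) ≤ T * (2 * Real.log L) * (64 * L ^ 3) := by
          gcongr; exact hlog1 L hL
      _ = T * 128 * (L ^ 3 * Real.log L) := by ring
      _ ≤ T * 128 * (κ / 128 * (d ^ 2 * v * n)) :=
          mul_le_mul_of_nonneg_left (k1.trans k2) (by positivity)
      _ = _ := by ring
  have g2 : 2 * (L + 1) * n * Real.log (T + 1) ≤ S := by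
    have k1 : L ^ 4 * Real.log T ≤ L ^ 5 * Real.log T :=
      mul_le_mul_of_nonneg_right (pow_le_pow_right₀ (by linarith) (by norm_num)) hlT
    rw [hS, le_div_iff₀ (by positivity)]
    calc 2 * (L + 1) * n * Real.log (T + 1) * (64 * L ^ 3)
        ≤ 2 * (L + L) * n * (2 * Real.log T) * (64 * L ^ 3) := by
          have hlT1 : 0 ≤ Real.log (T + 1) := Real.log_nonneg (by linarith)
          gcongr
          · linarith
          · exact hlog1 T hT
      _ = 512 * n * (L ^ 4 * Real.log T) := by ring
      _ ≤ 512 * n * (κ / 512 * (d ^ 2 * v * T)) :=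
          mul_le_mul_of_nonneg_left (k1.trans h2.le) (by positivity)
      _ = _ := by ring
  have f2 : Real.exp (T * Real.log (L + 1) + 2 * (L + 1) * n * Real.log (T + 1) -
        (κ * T / L / (L + 1) * (v * n / L * d ^ 2) / 2) / 4) ≤ 1 / (L + 1) := by
    calc _ ≤ Real.exp (-Real.log (L + 1)) := by
          refine Real.exp_le_exp.2 ?_
          nlinarith
      _ = 1 / (L + 1) := by rw [Real.exp_neg, Real.exp_log (by positivity), one_div]
  calc _ ≤ (L + 1) ^ 2 * (1 / (L + 1) ^ 3) + 1 / (L + 1) := by gcongr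
    _ = _ := by field_simp; norm_num

/-- In a nontrivial model with separated rows, the separation `d` is at most one and the fraction
`v` is at most the number of hubs. -/
lemma separation_le {nL n : ℕ} {h : nL ≤ n} {A : Matrix (Fin (nL + 1)) (Fin n) ℝ}
    (hA : A ∈ paramSpace h) (hL : 0 < nL) {d v : ℝ} (hv : 0 < v) {V : Fin nL → Finset (Fin n)}
    (hVcard : ∀ i, v * n / nL ≤ ((V i).card : ℝ))
    (hVsep : ∀ (i : Fin nL) (i' : Fin (nL + 1)), i' ≠ i.succ →
      ∀ j ∈ V i, d ≤ A i.succ j - A i' j) : d ≤ 1 ∧ v ≤ nL := by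
  have hL' : (0 : ℝ) < nL := by exact_mod_cast hL
  have hn' : (0 : ℝ) < n := by exact_mod_cast hL.trans_le h
  have hcard := hVcard ⟨0, hL⟩
  constructor
  · have hpos : 0 < (V ⟨0, hL⟩).card := by
      have : (0 : ℝ) < (V ⟨0, hL⟩).card := lt_of_lt_of_le (by positivity) hcard
      exact_mod_cast this
    obtain ⟨j, hj⟩ := Finset.card_pos.1 hpos
    linarith [hVsep ⟨0, hL⟩ 0 (Fin.succ_ne_zero _).symm j hj,
      (hA.1 (Fin.succ ⟨0, hL⟩) j).2, (hA.1 0 j).1]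
  · have h1 : ((V ⟨0, hL⟩).card : ℝ) ≤ n := by
      exact_mod_cast (Finset.card_le_univ _).trans (by simp)
    have h2 := hcard.trans h1
    rw [div_le_iff₀ hL', mul_comm] at h2
    exact le_of_mul_le_mul_left h2 hn'

/-- Subadditivity suffices here, so the events need not be measurable. -/
lemma tendsto_measure_one_of_compl_le {Ω : ℕ → Type*} [∀ m, MeasurableSpace (Ω m)]
    (μ : ∀ m, Measure (Ω m)) [∀ m, IsProbabilityMeasure (μ m)] (s : ∀ m, Set (Ω m)) (e : ℕ → ℝ)
    (he : Filter.Tendsto e Filter.atTop (nhds 0))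
    (hs : ∀ᶠ m in Filter.atTop, μ m (s m)ᶜ ≤ ENNReal.ofReal (e m)) :
    Filter.Tendsto (fun m => μ m (s m)) Filter.atTop (nhds 1) := by
  have h1 : Filter.Tendsto (fun m => 1 - ENNReal.ofReal (e m)) Filter.atTop (nhds 1) := by
    have := ENNReal.Tendsto.sub (tendsto_const_nhds (x := (1 : ENNReal)) (f := Filter.atTop))
      (ENNReal.tendsto_ofReal he) (Or.inl ENNReal.one_ne_top)
    simpa using this
  refine tendsto_of_tendsto_of_tendsto_of_le_of_le' h1 tendsto_const_nhds ?_
    (Filter.Eventually.of_forall fun m => prob_le_one)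
  filter_upwards [hs] with m hm
  rw [tsub_le_iff_right]
  calc (1 : ENNReal) = μ m Set.univ := measure_univ.symm
    _ = μ m (s m ∪ (s m)ᶜ) := by rw [Set.union_compl_self]
    _ ≤ μ m (s m) + μ m (s m)ᶜ := measure_union_le _ _
    _ ≤ _ := add_le_add le_rfl hm

end HubModel

theorem theorem8
    -- the sizes of the hub set, of the node set and of the sample
    (nL n T : ℕ → ℕ) (hle : ∀ m, nL m ≤ n m)
    (hnL : Filter.Tendsto nL Filter.atTop Filter.atTop)
    (hn : Filter.Tendsto n Filter.atTop Filter.atTop)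
    (hT : Filter.Tendsto T Filter.atTop Filter.atTop)
    -- the parameters
    (ρ : ∀ m, Fin (nL m + 1) → ℝ) (hρ : ∀ m, ∑ i, ρ m i = 1)
    (cmin cmax : ℝ) (hcmin : 0 < cmin) (hcmax : 0 < cmax)
    (hρmin : ∀ m i, cmin / nL m ≤ ρ m i) (hρmax : ∀ m i, ρ m i ≤ cmax / nL m)
    (A : ∀ m, Matrix (Fin (nL m + 1)) (Fin (n m)) ℝ)
    (hA : ∀ m, A m ∈ HubModel.paramSpace (hle m))
    -- condition (i)
    (d v : ℕ → ℝ) (hd : ∀ m, 0 < d m) (hv : ∀ m, 0 < v m)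
    (V : ∀ m, Fin (nL m) → Finset (Fin (n m)))
    (hVcard : ∀ m i, v m * n m / nL m ≤ ((V m i).card : ℝ))
    (hVsep : ∀ m (i : Fin (nL m)) (i' : Fin (nL m + 1)), i' ≠ i.succ →
      ∀ j ∈ V m i, d m ≤ A m i.succ j - A m i' j)
    -- condition (ii)
    (c₀ : ℝ) (hc₀ : 0 < c₀)
    (hAub : ∀ m (i : Fin (nL m + 1)) (i' : Fin (nL m)), i ≠ i'.succ →
      A m i (Fin.castLE (hle m) i') ≤ c₀ / nL m)
    -- the rates
    (hrate₁ : Filter.Tendsto (fun m => (nL m : ℝ) ^ 2 * Real.log (nL m) / (T m : ℝ))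
      Filter.atTop (nhds 0))
    (hrate₂ : Filter.Tendsto
      (fun m => (nL m : ℝ) ^ 5 * Real.log (T m) / (d m ^ 2 * v m * (T m : ℝ)))
      Filter.atTop (nhds 0))
    (hrate₃ : Filter.Tendsto
      (fun m => (nL m : ℝ) ^ 8 * Real.log (nL m) / (d m ^ 4 * v m ^ 2 * (n m : ℝ)))
      Filter.atTop (nhds 0))
    -- true labels, data, and a maximum profile likelihood estimator
    (Ω : ℕ → Type*) [∀ m, MeasurableSpace (Ω m)]
    (μ : ∀ m, MeasureTheory.Measure (Ω m)) [∀ m, MeasureTheory.IsProbabilityMeasure (μ m)]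
    (zs : ∀ m, Ω m → Fin (T m) → Fin (nL m + 1))
    (G : ∀ m, Ω m → Fin (T m) → Fin (n m) → Bool)
    (hmodel : ∀ m, HubModel.IsHubNullModel (μ m) (ρ m) (A m) (zs m) (G m))
    (zhat : ∀ m, Ω m → Fin (T m) → Fin (nL m + 1))
    (hzhat_meas : ∀ m, Measurable (zhat m))
    (hzhat : ∀ m, ∀ᵐ ω ∂(μ m), HubModel.IsProfileMLE (hle m) (G m ω) (zhat m ω))
    (η : ℝ) (hη : 0 < η) :
    Filter.Tendsto
      (fun m => μ m {ω | ∀ i : Fin (nL m),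
        0 < HubModel.trueCount (zs m ω) i.succ ∧
        (HubModel.crossCount (zs m ω) (zhat m ω) i.succ 0 : ℝ) /
          (HubModel.trueCount (zs m ω) i.succ : ℝ) ≤ η})
      Filter.atTop (nhds 1) := by
  -- The first bound gives `(nL + 1) * τ ≤ a / 4`, the second `τ ≤ η * (a / 2)`, where `a / 2` is
  -- the lower bound for the true counts.
  set κ : ℝ := min (cmin / 4) (η * (cmin / 2)) with hκdef
  have hκ : 0 < κ := lt_min (by positivity) (by positivity)
  refine HubModel.tendsto_measure_one_of_compl_le μ _ (fun m => 2 / ((nL m : ℝ) + 1)) ?_ ?_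
  · exact tendsto_const_nhds.div_atTop (Filter.tendsto_atTop_add_const_right _ _
      (tendsto_natCast_atTop_atTop.comp hnL))
  -- Beyond this size, `T * (cmax / nL) * (c₀ / nL)`, which bounds the mean off-diagonal counts, is
  -- at most `a / 16`.
  have hLlarge : ∀ᶠ m in Filter.atTop, 16 * cmax * c₀ / cmin ≤ (nL m : ℝ) :=
    (tendsto_natCast_atTop_atTop.comp hnL).eventually_ge_atTop _
  filter_upwards [hnL.eventually_ge_atTop 2, hT.eventually_ge_atTop 2, hLlarge,
    hrate₁.eventually_lt_const (by positivity : 0 < cmin / 60),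
    hrate₂.eventually_lt_const (by positivity : 0 < κ / 512),
    hrate₃.eventually_lt_const (by positivity : 0 < κ / 128)] with m hL2 hT2 hLc r1 r2 r3
  have hL2' : (2 : ℝ) ≤ nL m := by exact_mod_cast hL2
  have hT2' : (2 : ℝ) ≤ T m := by exact_mod_cast hT2
  have hn1' : (1 : ℝ) ≤ n m := by
    exact_mod_cast (by omega : 1 ≤ nL m).trans (hle m)
  have hL0 : (0 : ℝ) < nL m := by linarith
  have hT0 : (0 : ℝ) < T m := by linarith
  have hn0 : (0 : ℝ) < n m := by linarith
  have hdm := hd m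
  have hvm := hv m
  obtain ⟨hd1, hvL⟩ := HubModel.separation_le (hA m) (by omega) (hv m) (hVcard m) (hVsep m)
  have hρ0 : ∀ i, 0 ≤ ρ m i := fun i => le_trans (by positivity) (hρmin m i)
  have hκ1 : κ ≤ cmin / 4 := min_le_left _ _
  have hκ2 : κ ≤ η * (cmin / 2) := min_le_right _ _
  have hτle : κ * T m / nL m / (nL m + 1) ≤ κ * T m / nL m :=
    div_le_self (by positivity) (by linarith)
  -- Here `a` is a lower bound for the expected class sizes, `τ` is of order `a / nL` so that a
  -- whole row of small cells stays below `a / 4`, and `R` is the largest radius allowed by `2 * R ≤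
  -- τ * (W * δ ^ 2)`.
  have hmain := (hmodel m).measure_compl_le hρ0 (hρ m) (hA m) (V := V m) (δ := d m)
    (W := v m * n m / nL m) (τ := κ * T m / nL m / (nL m + 1))
    (R := κ * T m / nL m / (nL m + 1) * (v m * n m / nL m * d m ^ 2) / 2)
    (a := cmin * T m / nL m) (hd m) (by positivity) (hVcard m) (hVsep m) (by positivity)
    (by positivity) ?_ (by linarith) ?_ ?_ (hzhat m)
  · refine (MeasureTheory.measure_mono (Set.compl_subset_compl.2 fun ω hω i => ?_)).trans
      (hmain.trans (ENNReal.ofReal_le_ofReal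
        (HubModel.error_bound_le hL2' hn1' hT2' hdm hd1 hvm hvL hκ r1 r2 r3)))
    obtain ⟨htrue, hcross⟩ := hω i
    have hpos : (0 : ℝ) < HubModel.trueCount (zs m ω) i.succ :=
      lt_of_le_of_lt (by positivity) htrue
    refine ⟨by exact_mod_cast hpos, ?_⟩
    rw [div_le_iff₀ hpos]
    calc _ ≤ _ := hcross.trans hτle
      _ ≤ η * (cmin / 2) * T m / nL m := by gcongr
      _ = η * (cmin * T m / nL m / 2) := by ring
      _ ≤ _ := mul_le_mul_of_nonneg_left htrue.le hη.le
  · rw [mul_div_cancel₀ _ (by positivity)]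
    calc κ * T m / nL m ≤ cmin / 4 * T m / nL m := by gcongr
      _ = _ := by ring
  · intro i
    calc cmin * T m / nL m = T m * (cmin / nL m) := by ring
      _ ≤ _ := mul_le_mul_of_nonneg_left (hρmin m i) hT0.le
  · intro i k hik
    rw [div_le_iff₀ hcmin] at hLc
    calc T m * (ρ m i * A m i (Fin.castLE (hle m) k))
        ≤ T m * (cmax / nL m * (c₀ / nL m)) := by
          refine mul_le_mul_of_nonneg_left ?_ hT0.le
          exact mul_le_mul (hρmax m i) (hAub m i k hik) ((hA m).1 _ _).1 (by positivity)
      _ = T m * (cmax * c₀) / (nL m * nL m) := by field_simp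
      _ ≤ cmin * T m / nL m / 16 := by
          rw [div_div, div_le_div_iff₀ (by positivity) (by positivity)]
          nlinarith [mul_le_mul_of_nonneg_left hLc (by positivity : 0 ≤ (T m : ℝ) * nL m)]
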